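/- Let $G$ be a finite dimensional, Hausdorff, second countable real Lie group (with its real analytic structure) with Lie algebra $\mathfrak g=T_eG$ and dual $\mathfrak g'=L(\mathfrak g,\mathbb R)$, and let $\rho:G\to U(H)$ be a unitary representation on a complex Hilbert space $H$ such that $g\mapsto\rho(g)x$ is continuous for each $x\in H$. Let $H_\infty$ (respectively $H_\omega$) be the space of all $x\in H$ for which $g\mapsto\rho(g)x$, $G\to H$, is smooth (respectively real analytic). The space $H_\infty$ carries the topology induced by the embedding $H_\infty\to C^\infty(G,H)$, $x\mapsto(g\mapsto\rho(g)x)$, where $C^\infty(G,H)$ has the compact $C^\infty$-topology (uniform convergence on compact sets, in all derivatives separately). The space $H_\omega$ carries the topology induced by the analogous embedding $H_\omega\to C^\omega(G,H)$, where $C^\omega(G,H)$ has its convenient vector space structure: a set $B\subset C^\omega(G,H)$ is bounded iff for each continuous real linear functional $\ell$ on $H$, each chart $\varphi$ of $G$ and each compact set $K$ in the image of $\varphi$ there are constants $C,r$ with $\|D^k(\ell\circ f\circ\varphi^{-1})(y)\|\le C\,r^k\,k!$ for all $f\in B$, $y\in K$, $k\ge 0$; and the topology is the locally convex topology given by all seminorms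 that are bounded on bounded sets. Write $\langle x,y\rangle$ for the inner product, linear in $x$, put $\omega(x,y)=\operatorname{Im}\langle x,y\rangle$, and let $\rho'(X)x=T_e(g\mapsto\rho(g)x)(X)$ for $X\in\mathfrak g$ and $x\in H_\infty$. The moment mapping is $$\mu:H_\infty\to\mathfrak g',\qquad \mu(x)(X)=\tfrac12\,\omega(\rho'(X)x,x).$$ A curve $c$ in a locally convex space $V$ is called smooth if all its derivatives exist and are continuous, and real analytic if $\ell\circ c:\mathbb R\to\mathbb R$ is real analytic for every bounded linear functional $\ell$ on $V$. A mapping between such spaces is called smooth if it maps smooth curves to smooth curves, and real analytic (in the sense of Kriegl and Michor) if it moreover maps real analytic curves to real analytic curves. **Theorem.** Every real analytic vector is smooth, and the inclusion $i:H_\omega\to H_\infty$ is linear, injective, continuous and $G$-equivariant, i.e. $i(\rho(g)x)=\rho(g)i(x)$. The moment mapping $\mu:H_\infty\to\mathfrak g'$ is smooth, and the composition $\mu\circ i:H_\omega\to\mathfrak g'$ is real analytic. (It is called the real analytic moment mapping.) -/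

import Mathlib

open scoped Manifold ContDiff
open Topology Filter

noncomputable section

namespace UnitaryMoment

/-! ### Convenient calculus on locally convex spaces -/

section Calculus

variable {V W : Type*} [AddCommGroup V] [Module ℝ V] [TopologicalSpace V]
  [AddCommGroup W] [Module ℝ W] [TopologicalSpace W]

/-- A curve `c : ℝ → V` is smooth if all its iterated derivatives exist and are continuous:
`D n` is the `n`-th derivative, obtained as a limit of difference quotients. -/
def IsSmoothCurve (c : ℝ → V) : Prop :=
  ∃ D : ℕ → ℝ → V, D 0 = c ∧ ∀ n, Continuous (D n) ∧
    ∀ t, Tendsto (fun h : ℝ => h⁻¹ • (D n (t + h) - D n t)) (𝓝[≠] 0) (𝓝 (D (n + 1) t))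

/-- A linear functional is bounded if it maps bounded sets to bounded sets. -/
def IsBoundedFunctional (l : V →ₗ[ℝ] ℝ) : Prop :=
  ∀ B : Set V, Bornology.IsVonNBounded ℝ B → Bornology.IsBounded (l '' B)

/-- A curve `c : ℝ → V` is real analytic if `l ∘ c : ℝ → ℝ` is real analytic for every bounded
linear functional `l` on `V`. -/
def IsRealAnalyticCurve (c : ℝ → V) : Prop :=
  ∀ l : V →ₗ[ℝ] ℝ, IsBoundedFunctional l → AnalyticOnNhd ℝ (fun t => l (c t)) Set.univ

/-- A mapping is smooth if it maps smooth curves to smooth curves. -/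
def IsSmoothMap (f : V → W) : Prop :=
  ∀ c : ℝ → V, IsSmoothCurve c → IsSmoothCurve (fun t => f (c t))

/-- A mapping is real analytic (in the sense of Kriegl and Michor) if it maps smooth curves to
smooth curves and real analytic curves to real analytic curves. -/
def IsRealAnalyticMap (f : V → W) : Prop :=
  IsSmoothMap f ∧
    ∀ c : ℝ → V, IsRealAnalyticCurve c → IsRealAnalyticCurve (fun t => f (c t))

end Calculus

/-! ### Spaces of smooth and of real analytic functions on a finite dimensional manifold -/

section FunctionSpaces

variable (E : Type*) [NormedAddCommGroup E] [NormedSpace ℝ E]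
  (G : Type*) [TopologicalSpace G] [ChartedSpace E G]
  (F : Type*) [NormedAddCommGroup F] [NormedSpace ℝ F]

/-- The compact `C^∞`-topology on `C^∞(G, F)`: uniform convergence, on the compact subsets of the
chart domains, of each iterated derivative (in the chart) separately. -/
@[reducible] def compactSmoothTopology : TopologicalSpace C^∞⟮𝓘(ℝ, E), G; 𝓘(ℝ, F), F⟯ :=
  ⨅ (g : G) (k : ℕ),
    TopologicalSpace.induced
      (fun f => UniformOnFun.ofFun {K : Set E | IsCompact K ∧ K ⊆ (chartAt E g).target}
        (iteratedFDeriv ℝ k (fun y => f ((chartAt E g).symm y))))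
      inferInstance

variable {E G F}

/-- The bounded subsets of the space `C^ω(G, ℝ)` of real analytic functions (carrying its usual
topology, as the real part of the space of germs of holomorphic functions along `G` on a
complexification of `G`): on each compact subset `K` of a chart domain, the functions in the set
extend to, and are uniformly bounded on, a common complex neighbourhood of `K`. This is expressed
by uniform Cauchy estimates for the derivatives in the chart. -/
def IsBoundedAnalyticReal (B : Set C^ω⟮𝓘(ℝ, E), G; 𝓘(ℝ, ℝ), ℝ⟯) : Prop :=
  ∀ (g : G) (K : Set E), IsCompact K → K ⊆ (chartAt E g).target →
    ∃ C r : ℝ, ∀ f ∈ B, ∀ y ∈ K, ∀ k : ℕ,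
      ‖iteratedFDeriv ℝ k (fun z => f ((chartAt E g).symm z)) y‖ ≤ C * r ^ k * (k.factorial : ℝ)

/-- Composition with a continuous linear functional, `C^ω(G, F) → C^ω(G, ℝ)`. -/
def analyticPostcomp (l : F →L[ℝ] ℝ) (f : C^ω⟮𝓘(ℝ, E), G; 𝓘(ℝ, F), F⟯) :
    C^ω⟮𝓘(ℝ, E), G; 𝓘(ℝ, ℝ), ℝ⟯ :=
  ⟨fun g => l (f g), l.contMDiff.comp f.contMDiff⟩

/-- The bounded subsets of `C^ω(G, F)`: the convenient structure of `C^ω(G, F)` is the initial one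
with respect to the mappings `f ↦ l ∘ f` into `C^ω(G, ℝ)`, for `l` in the dual of `F`. -/
def IsBoundedAnalytic (B : Set C^ω⟮𝓘(ℝ, E), G; 𝓘(ℝ, F), F⟯) : Prop :=
  ∀ l : F →L[ℝ] ℝ, IsBoundedAnalyticReal (analyticPostcomp l '' B)

variable (E G F)

/-- The seminorms on `C^ω(G, F)` that are bounded on bounded sets. -/
def boundedSeminorms :
    SeminormFamily ℝ C^ω⟮𝓘(ℝ, E), G; 𝓘(ℝ, F), F⟯
      {p : Seminorm ℝ C^ω⟮𝓘(ℝ, E), G; 𝓘(ℝ, F), F⟯ //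
        ∀ B, IsBoundedAnalytic B → BddAbove (p '' B)} :=
  fun p => p.1

/-- The (bornological) locally convex topology of the convenient vector space `C^ω(G, F)`, defined
by all seminorms that are bounded on bounded sets. -/
@[reducible] def analyticTopology : TopologicalSpace C^ω⟮𝓘(ℝ, E), G; 𝓘(ℝ, F), F⟯ :=
  haveI : Nonempty {p : Seminorm ℝ C^ω⟮𝓘(ℝ, E), G; 𝓘(ℝ, F), F⟯ //
      ∀ B, IsBoundedAnalytic B → BddAbove (p '' B)} :=
    ⟨⟨0, fun _ _ => ⟨0, by rintro _ ⟨f, _, rfl⟩; simp⟩⟩⟩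
  (boundedSeminorms E G F).moduleFilterBasis.topology

end FunctionSpaces

/-! ### Smooth and real analytic vectors of a unitary representation -/

section Vectors

variable {E : Type*} [NormedAddCommGroup E] [NormedSpace ℝ E]
  {G : Type*} [TopologicalSpace G] [ChartedSpace E G] [Group G]
  {H : Type*} [NormedAddCommGroup H] [InnerProductSpace ℂ H]

/-- The vectors `x` for which the orbit map `g ↦ ρ(g)x`, `G → H`, is of class `C^n`. -/
def orbitRegular (E : Type*) [NormedAddCommGroup E] [NormedSpace ℝ E]
    {G : Type*} [TopologicalSpace G] [ChartedSpace E G] [Group G]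
    {H : Type*} [NormedAddCommGroup H] [InnerProductSpace ℂ H]
    (n : WithTop ℕ∞) (ρ : G →* (H ≃ₗᵢ[ℂ] H)) : Submodule ℂ H where
  carrier := {x | ContMDiff 𝓘(ℝ, E) 𝓘(ℝ, H) n (fun g => ρ g x)}
  add_mem' {x y} hx hy := by
    have : (fun g => ρ g (x + y)) = fun g => ρ g x + ρ g y := by ext g; simp
    simp only [Set.mem_ofPred_eq] at *
    rw [this]; exact hx.add hy
  zero_mem' := by
    simp only [Set.mem_ofPred_eq, map_zero]; exact contMDiff_const
  smul_mem' a x hx := by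
    have h : (fun g => ρ g (a • x)) =
        (((a • ContinuousLinearMap.id ℂ H).restrictScalars ℝ : H →L[ℝ] H)) ∘ fun g => ρ g x := by
      ext g; simp
    simp only [Set.mem_ofPred_eq] at *
    rw [h]; exact (ContinuousLinearMap.contMDiff _).comp hx

/-- The space `H_∞` of smooth vectors. -/
def SmoothVectors (E : Type*) [NormedAddCommGroup E] [NormedSpace ℝ E]
    {G : Type*} [TopologicalSpace G] [ChartedSpace E G] [Group G]
    {H : Type*} [NormedAddCommGroup H] [InnerProductSpace ℂ H]
    (ρ : G →* (H ≃ₗᵢ[ℂ] H)) : Type _ := orbitRegular E ∞ ρ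

/-- The space `H_ω` of real analytic vectors. -/
def AnalyticVectors (E : Type*) [NormedAddCommGroup E] [NormedSpace ℝ E]
    {G : Type*} [TopologicalSpace G] [ChartedSpace E G] [Group G]
    {H : Type*} [NormedAddCommGroup H] [InnerProductSpace ℂ H]
    (ρ : G →* (H ≃ₗᵢ[ℂ] H)) : Type _ := orbitRegular E ω ρ

variable (ρ : G →* (H ≃ₗᵢ[ℂ] H))

instance : AddCommGroup (SmoothVectors E ρ) := inferInstanceAs (AddCommGroup (orbitRegular E ∞ ρ))
instance : Module ℂ (SmoothVectors E ρ) := inferInstanceAs (Module ℂ (orbitRegular E ∞ ρ))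
instance : Module ℝ (SmoothVectors E ρ) := Module.complexToReal (SmoothVectors E ρ)
instance : AddCommGroup (AnalyticVectors E ρ) := inferInstanceAs (AddCommGroup (orbitRegular E ω ρ))
instance : Module ℂ (AnalyticVectors E ρ) := inferInstanceAs (Module ℂ (orbitRegular E ω ρ))
instance : Module ℝ (AnalyticVectors E ρ) := Module.complexToReal (AnalyticVectors E ρ)

/-- The embedding `j : H_∞ → C^∞(G, H)`, `x ↦ (g ↦ ρ(g)x)`. -/
def SmoothVectors.orbitMap (x : SmoothVectors E ρ) : C^∞⟮𝓘(ℝ, E), G; 𝓘(ℝ, H), H⟯ :=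
  ⟨fun g => ρ g x.1, x.2⟩

/-- The embedding `j : H_ω → C^ω(G, H)`, `x ↦ (g ↦ ρ(g)x)`. -/
def AnalyticVectors.orbitMap (x : AnalyticVectors E ρ) : C^ω⟮𝓘(ℝ, E), G; 𝓘(ℝ, H), H⟯ :=
  ⟨fun g => ρ g x.1, x.2⟩

/-- `H_∞` carries the topology induced from the compact `C^∞`-topology on `C^∞(G, H)`. -/
instance : TopologicalSpace (SmoothVectors E ρ) :=
  TopologicalSpace.induced (SmoothVectors.orbitMap ρ) (compactSmoothTopology E G H)

/-- `H_ω` carries the topology induced from the convenient vector space `C^ω(G, H)`. -/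
instance : TopologicalSpace (AnalyticVectors E ρ) :=
  TopologicalSpace.induced (AnalyticVectors.orbitMap ρ) (analyticTopology E G H)

/-- The linear mapping `i : H_ω → H_∞`, `x ↦ x`. -/
def incl : AnalyticVectors E ρ →ₗ[ℂ] SmoothVectors E ρ :=
  Submodule.inclusion (p := orbitRegular E ω ρ) (p' := orbitRegular E ∞ ρ)
    fun _ hx => ContMDiff.of_le hx (by exact le_top)

/-- `ρ(g)` maps `C^n`-regular vectors to `C^n`-regular vectors. -/
theorem orbitRegular_map [LieGroup 𝓘(ℝ, E) ω G] (n : WithTop ℕ∞) (g : G) {x : H}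
    (hx : x ∈ orbitRegular E n ρ) : ρ g x ∈ orbitRegular E n ρ := by
  have h : (fun h => ρ h (ρ g x)) = (fun h => ρ h x) ∘ fun h => h * g := by
    ext h; simp
  have hm : ContMDiff 𝓘(ℝ, E) 𝓘(ℝ, E) n (fun h : G => h * g) :=
    (contMDiff_mul_right (I := 𝓘(ℝ, E)) (n := ω) (a := g)).of_le le_top
  change ContMDiff _ _ _ _
  rw [h]
  exact ContMDiff.comp hx hm

/-- The representation of `G` on `H_∞`. -/
def SmoothVectors.act [LieGroup 𝓘(ℝ, E) ω G] (g : G) (x : SmoothVectors E ρ) :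
    SmoothVectors E ρ :=
  ⟨ρ g x.1, orbitRegular_map ρ ∞ g x.2⟩

/-- The representation of `G` on `H_ω`. -/
def AnalyticVectors.act [LieGroup 𝓘(ℝ, E) ω G] (g : G) (x : AnalyticVectors E ρ) :
    AnalyticVectors E ρ :=
  ⟨ρ g x.1, orbitRegular_map ρ ω g x.2⟩

/-- The symplectic form `(x, y) ↦ Im ⟨x, y⟩`, where `⟨x, y⟩` is linear in `x` and conjugate linear
in `y`; Mathlib's inner product has the opposite convention. -/
def symp (x y : H) : ℝ := (inner ℂ y x).im

/-- The infinitesimal representation: `ρ'(X)x` is the derivative at `e` of `g ↦ ρ(g)x` in the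
direction `X ∈ 𝔤 = T_e G`. -/
def infRep (X : GroupLieAlgebra 𝓘(ℝ, E) G) (x : SmoothVectors E ρ) : H :=
  mfderiv 𝓘(ℝ, E) 𝓘(ℝ, H) (fun g => ρ g x.1) (1 : G) X

/-- The moment mapping `μ : H_∞ → 𝔤'`, `μ(x)(X) = (1/2) Im ⟨ρ'(X)x, x⟩`. -/
def momentMap [FiniteDimensional ℝ E] (x : SmoothVectors E ρ) :
    GroupLieAlgebra 𝓘(ℝ, E) G →L[ℝ] ℝ where
  toFun X := (1 / 2) * symp (infRep ρ X x) x.1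
  map_add' X Y := by
    have h : infRep ρ (X + Y) x = infRep ρ X x + infRep ρ Y x := map_add _ X Y
    simp only [symp, h, inner_add_right, Complex.add_im]; ring
  map_smul' a X := by
    have h : infRep ρ (a • X) x = a • infRep ρ X x := map_smul _ a X
    simp only [symp, h, ← Complex.coe_smul, inner_smul_right, Complex.im_ofReal_mul, RingHom.id_apply, smul_eq_mul]; ring
  cont := by
    have h : Continuous (fun X : GroupLieAlgebra 𝓘(ℝ, E) G => infRep ρ X x) :=
      (mfderiv 𝓘(ℝ, E) 𝓘(ℝ, H) (fun g => ρ g x.1) (1 : G)).continuous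
    exact continuous_const.mul (Complex.continuous_im.comp (continuous_const.inner h))

end Vectors

end UnitaryMoment

end

/-! For fixed `X`, `μ(x)(X)` is half the imaginary part of the inner product of two real linear
images of `x` in `H`, namely `x` and `ρ'(X)x`. Both depend continuously on `x ∈ H_∞`: they are read
off from the orbit map's chart derivatives of order 0 and 1 at `e`. As `𝔤'` is finite dimensional,
one `X` at a time suffices, and smoothness of `μ` follows.

Real analytic curves in `H_ω` are only tested by scalar functionals, so two further facts are
needed. First, `i` is continuous, so functionals continuous on `H_∞` are admissible tests: uniform
boundedness turns the scalarwise estimates defining bounded sets of `C^ω(G, H)` into norm estimates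
(`bddAbove_compactDerivSeminorm`). Second, a weakly real analytic curve in a Hilbert space is
analytic in norm, by a Baire argument (`analyticOnNhd_of_inner`). Hence `x` and `ρ'(X)x` become
analytic along the curve, and so does their inner product. -/

noncomputable section

namespace UnitaryMoment

/-! ### Smooth curves and bounded functionals -/

section Curves

variable {F : Type*} [NormedAddCommGroup F] [NormedSpace ℝ F]

theorem isSmoothCurve_iff_contDiff {c : ℝ → F} : IsSmoothCurve c ↔ ContDiff ℝ ∞ c := by
  constructor
  · rintro ⟨D, rfl, hD⟩
    have hder (n : ℕ) (t : ℝ) : HasDerivAt (D n) (D (n + 1) t) t :=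
      hasDerivAt_iff_tendsto_slope_zero.2 ((hD n).2 t)
    refine contDiff_infty.2 fun k => ?_
    suffices ∀ n, ContDiff ℝ k (D n) from this 0
    induction k with
    | zero => exact fun n => contDiff_zero.2 (hD n).1
    | succ k ih =>
      intro n
      have : deriv (D n) = D (n + 1) := funext fun t => (hder n t).deriv
      rw [Nat.cast_add, Nat.cast_one, contDiff_succ_iff_deriv, this]
      exact ⟨fun t => (hder n t).differentiableAt, by simp, ih (n + 1)⟩
  · intro hc
    refine ⟨fun n => iteratedDeriv n c, iteratedDeriv_zero, fun n =>
      ⟨hc.continuous_iteratedDeriv n (by exact_mod_cast le_top), fun t => ?_⟩⟩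
    refine hasDerivAt_iff_tendsto_slope_zero.1 ?_
    change HasDerivAt _ (iteratedDeriv (n + 1) c t) t
    rw [iteratedDeriv_succ]
    exact (hc.differentiable_iteratedDeriv n (by exact_mod_cast WithTop.coe_lt_top _) t).hasDerivAt

variable {V W : Type*} [AddCommGroup V] [Module ℝ V] [TopologicalSpace V]
  [AddCommGroup W] [Module ℝ W] [TopologicalSpace W]

theorem IsSmoothCurve.map_of_continuous {c : ℝ → V} (hc : IsSmoothCurve c) (L : V →ₗ[ℝ] W)
    (hL : Continuous L) : IsSmoothCurve fun t => L (c t) := by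
  obtain ⟨D, rfl, hD⟩ := hc
  refine ⟨fun n t => L (D n t), rfl, fun n => ⟨hL.comp (hD n).1, fun t => ?_⟩⟩
  simpa only [Function.comp_def, map_smul, map_sub] using
    (hL.tendsto _).comp ((hD n).2 t)

theorem isBoundedFunctional_of_continuous (l : V →ₗ[ℝ] ℝ) (hl : Continuous l) :
    IsBoundedFunctional l := fun _ hB =>
  (NormedSpace.isVonNBounded_iff ℝ).1 (hB.image (⟨l, hl⟩ : V →L[ℝ] ℝ))

end Curves

/-! ### Weakly analytic curves in a Hilbert space -/

section WeaklyAnalytic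

variable {F : Type*} [NormedAddCommGroup F] [InnerProductSpace ℝ F] [CompleteSpace F]

local notation "⟪" x ", " y "⟫" => inner ℝ x y

/-- The weak derivatives of a weakly smooth curve in a Hilbert space are represented by vectors. -/
theorem exists_inner_eq_iteratedDeriv {c : ℝ → F} (hc : ∀ v, ContDiff ℝ ∞ fun t => ⟪v, c t⟫)
    (n : ℕ) (t : ℝ) : ∃ d : F, ∀ v, ⟪v, d⟫ = iteratedDeriv n (fun t => ⟪v, c t⟫) t := by
  induction n generalizing t with
  | zero => exact ⟨c t, fun v => by simp⟩
  | succ n ih =>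
    choose D hD using ih
    have hlim (v : F) : Tendsto (fun h : ℝ => innerSL ℝ (h⁻¹ • (D (t + h) - D t)) v) (𝓝[≠] 0)
        (𝓝 (iteratedDeriv (n + 1) (fun t => ⟪v, c t⟫) t)) := by
      have hd : HasDerivAt (iteratedDeriv n fun t => ⟪v, c t⟫)
          (iteratedDeriv (n + 1) (fun t => ⟪v, c t⟫) t) t := by
        rw [iteratedDeriv_succ]
        exact ((hc v).differentiable_iteratedDeriv n
          (by exact_mod_cast WithTop.coe_lt_top _) t).hasDerivAt
      refine (hasDerivAt_iff_tendsto_slope_zero.1 hd).congr fun h => ?_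
      rw [innerSL_apply_apply, real_inner_comm, inner_smul_right, inner_sub_right, hD, hD, smul_eq_mul]
    -- By Banach–Steinhaus the pointwise limit of the difference quotients, viewed as functionals,
    -- is again continuous; the Riesz theorem then gives the vector.
    let b : F →L[ℝ] ℝ := continuousLinearMapOfTendsto _ (tendsto_pi_nhds.2 hlim)
    refine ⟨(InnerProductSpace.toDual ℝ F).symm b, fun v => ?_⟩
    rw [real_inner_comm, InnerProductSpace.toDual_symm_apply]
    rfl

/-- If each `⟪v, d n⟫` grows at most geometrically, then so does `d n`. -/
theorem exists_norm_le_geometric {d : ℕ → F}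
    (hd : ∀ v, ∃ N : ℕ, ∀ n, |⟪v, d n⟫| ≤ N * (N : ℝ) ^ n) :
    ∃ (C : ℝ) (N : ℕ), ∀ n, ‖d n‖ ≤ C * (N : ℝ) ^ n := by
  -- Baire: countably many closed sets cover the space, so one `N` works on a whole ball.
  obtain ⟨N, v₀, hv₀⟩ := nonempty_interior_of_iUnion_of_closed
    (f := fun N : ℕ => {v | ∀ n, |⟪v, d n⟫| ≤ N * (N : ℝ) ^ n})
    (fun N => by
      simp only [Set.ofPred_forall]
      exact isClosed_iInter fun n => isClosed_le (by fun_prop) continuous_const)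
    (Set.eq_univ_of_forall fun v => Set.mem_iUnion.2 (hd v))
  obtain ⟨ε, hε, hball⟩ := Metric.isOpen_iff.1 isOpen_interior v₀ hv₀
  have hsub (v : F) (hv : ‖v‖ < ε) (n : ℕ) : |⟪v, d n⟫| ≤ 2 * (N * (N : ℝ) ^ n) := by
    have h₁ := interior_subset (hball (show v₀ + v ∈ Metric.ball v₀ ε by simpa using hv)) n
    have h₀ := interior_subset hv₀ n
    have : ⟪v, d n⟫ = ⟪v₀ + v, d n⟫ - ⟪v₀, d n⟫ := by rw [inner_add_left]; ring
    rw [this]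
    linarith [abs_sub ⟪v₀ + v, d n⟫ ⟪v₀, d n⟫]
  refine ⟨2 * N * (2 / ε), N, fun n => ?_⟩
  rcases eq_or_ne (d n) 0 with h0 | h0
  · rw [h0, norm_zero]; positivity
  -- Testing against `d n` itself, rescaled to norm `ε / 2`, recovers its norm.
  have hpos : 0 < ‖d n‖ := norm_pos_iff.2 h0
  have h := hsub ((ε / 2 / ‖d n‖) • d n) (by
    rw [norm_smul, Real.norm_of_nonneg (by positivity), div_mul_cancel₀ _ hpos.ne']
    linarith) n
  rw [real_inner_smul_left, real_inner_self_eq_norm_sq, abs_of_nonneg (by positivity)] at h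
  have h' : ε / 2 / ‖d n‖ * ‖d n‖ ^ 2 = ‖d n‖ * (ε / 2) := by field_simp
  rw [h', ← le_div_iff₀ (by positivity)] at h
  refine h.trans_eq ?_
  field_simp

/-- A weakly real analytic curve in a Hilbert space is real analytic. -/
theorem analyticOnNhd_of_inner {c : ℝ → F}
    (hc : ∀ v, AnalyticOnNhd ℝ (fun t => ⟪v, c t⟫) Set.univ) : AnalyticOnNhd ℝ c Set.univ := by
  intro t₀ _
  have hsmooth (v : F) : ContDiff ℝ ∞ fun t => ⟪v, c t⟫ :=
    contDiffOn_univ.1 (hc v).contDiffOn_of_completeSpace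
  choose D hD using fun n => exists_inner_eq_iteratedDeriv hsmooth n t₀
  let d : ℕ → F := fun n => (n.factorial : ℝ)⁻¹ • D n
  have hd (n : ℕ) (v : F) :
      ⟪v, d n⟫ = iteratedDeriv n (fun t => ⟪v, c t⟫) t₀ / (n.factorial : ℝ) := by
    simp only [d]
    rw [inner_smul_right, hD, div_eq_inv_mul]
  have hseries (v : F) := (hc v t₀ trivial).hasFPowerSeriesAt
  -- A single natural number serves as both constant and ratio, so that Baire meets only countably
  -- many sets.
  have hgeom (v : F) : ∃ N : ℕ, ∀ n, |⟪v, d n⟫| ≤ N * (N : ℝ) ^ n := by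
    obtain ⟨r, hr0, hr⟩ := ENNReal.lt_iff_exists_nnreal_btwn.1 (hseries v).radius_pos
    have hr0' : 0 < r := by exact_mod_cast hr0
    obtain ⟨C, hC, hb⟩ := FormalMultilinearSeries.norm_mul_pow_le_of_lt_radius _ hr
    obtain ⟨N, hN⟩ := exists_nat_ge (max C (r : ℝ)⁻¹)
    refine ⟨N, fun n => ?_⟩
    have h := hb n
    rw [FormalMultilinearSeries.norm_apply_eq_norm_coef, FormalMultilinearSeries.coeff_ofScalars,
      ← hd, Real.norm_eq_abs, ← le_div_iff₀ (by positivity)] at h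
    refine h.trans ?_
    rw [div_eq_mul_inv, ← inv_pow]
    gcongr
    · exact (le_max_left _ _).trans hN
    · exact (le_max_right _ _).trans hN
  obtain ⟨C, N, hCN⟩ := exists_norm_le_geometric hgeom
  let p : FormalMultilinearSeries ℝ ℝ F :=
    fun n => ContinuousMultilinearMap.mkPiRing ℝ (Fin n) (d n)
  have hp (n : ℕ) : p.coeff n = d n := by simp [FormalMultilinearSeries.coeff, p]
  have hrad : 0 < p.radius := by
    -- `N + 1` rather than `N`, since the inverse of `N = 0` would be the useless radius 0.
    refine lt_of_lt_of_le ?_ (p.le_radius_of_bound C (r := (N + 1 : NNReal)⁻¹) fun n => ?_)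
    · simp
    · rw [FormalMultilinearSeries.norm_apply_eq_norm_coef, hp]
      push_cast
      rw [inv_pow, ← div_eq_mul_inv, div_le_iff₀ (by positivity)]
      have hC : 0 ≤ C := by simpa using (norm_nonneg _).trans (hCN 0)
      refine (hCN n).trans ?_
      gcongr
      linarith
  have hsum := p.hasFPowerSeriesOnBall hrad
  -- The scalar Taylor series may converge on neighbourhoods depending on `v`; the identity theorem
  -- extends each equality to the common ball.
  have heq : ∀ s ∈ Metric.eball (0 : ℝ) p.radius, c (t₀ + s) = p.sum s := by
    intro s hs
    refine ext_inner_left ℝ fun v => ?_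
    have h₁ : AnalyticOnNhd ℝ (fun s => ⟪v, c (t₀ + s)⟫) (Metric.eball 0 p.radius) :=
      fun s _ => (hc v (t₀ + s) trivial).comp_of_eq (f := fun s => t₀ + s) (by fun_prop) rfl
    have h₂ : AnalyticOnNhd ℝ (fun s => ⟪v, p.sum s⟫) (Metric.eball 0 p.radius) :=
      fun s hs => ((innerSL ℝ v).analyticAt _).comp (hsum.analyticOnNhd s hs)
    refine h₁.eqOn_of_preconnected_of_eventuallyEq h₂
      (Metric.isConnected_eball hrad).isPreconnected (Metric.mem_eball_self hrad) ?_ hs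
    filter_upwards [hasFPowerSeriesAt_iff.1 (hseries v),
      hasFPowerSeriesAt_iff.1 hsum.hasFPowerSeriesAt] with s hs₁ hs₂
    refine hs₁.unique ?_
    have := (innerSL ℝ v).hasSum hs₂
    simpa only [FormalMultilinearSeries.coeff_ofScalars, ← hd, hp, innerSL_apply_apply,
      inner_smul_right, zero_add, smul_eq_mul] using this
  have hat : AnalyticAt ℝ (fun t => p.sum (t - t₀)) t₀ :=
    hsum.analyticAt.comp_of_eq (f := fun t => t - t₀) (by fun_prop) (sub_self _)
  refine hat.congr ?_
  have : ∀ᶠ t in 𝓝 t₀, t - t₀ ∈ Metric.eball (0 : ℝ) p.radius :=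
    (continuous_id.sub continuous_const).continuousAt.eventually_mem
      (by simpa using Metric.eball_mem_nhds (0 : ℝ) hrad)
  filter_upwards [this] with t ht
  rw [← heq _ ht, add_sub_cancel]

end WeaklyAnalytic

/-! ### Comparing the topologies of analytic and smooth functions -/

section FunctionSpaces

variable {E : Type*} [NormedAddCommGroup E] [NormedSpace ℝ E]
  {G : Type*} [TopologicalSpace G] [ChartedSpace E G]
  {F : Type*} [NormedAddCommGroup F] [NormedSpace ℝ F]

theorem contDiffAt_comp_chartAt_symm {n : WithTop ℕ∞} [IsManifold 𝓘(ℝ, E) n G] {f : G → F}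
    (hf : ContMDiff 𝓘(ℝ, E) 𝓘(ℝ, F) n f) (g : G) {y : E} (hy : y ∈ (chartAt E g).target) :
    ContDiffAt ℝ n (fun z => f ((chartAt E g).symm z)) y :=
  (contMDiffOn_iff_contDiffOn.1 (hf.comp_contMDiffOn contMDiffOn_chart_symm)).contDiffAt
    ((chartAt E g).open_target.mem_nhds hy)

variable [IsManifold 𝓘(ℝ, E) ω G]

theorem contDiffAt_chart_repr (f : C^ω⟮𝓘(ℝ, E), G; 𝓘(ℝ, F), F⟯) (g : G) {y : E}
    (hy : y ∈ (chartAt E g).target) (n : WithTop ℕ∞) :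
    ContDiffAt ℝ n (fun z => f ((chartAt E g).symm z)) y :=
  (contDiffAt_comp_chartAt_symm f.contMDiff g hy).of_le le_top

theorem bddAbove_range_iteratedFDeriv (g : G) {K : Set E} (hK : IsCompact K)
    (hKg : K ⊆ (chartAt E g).target) (k : ℕ) (f : C^ω⟮𝓘(ℝ, E), G; 𝓘(ℝ, F), F⟯) :
    BddAbove (Set.range fun y : K =>
      ‖iteratedFDeriv ℝ k (fun z => f ((chartAt E g).symm z)) y‖) := by
  have hcont : ContinuousOn
      (fun y => ‖iteratedFDeriv ℝ k (fun z => f ((chartAt E g).symm z)) y‖) K := fun y hy =>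
    (((contDiffAt_chart_repr f g (hKg hy) ω).iteratedFDeriv_right (m := 0) (i := k)
      le_top).continuousAt.norm).continuousWithinAt
  have := (hK.image_of_continuousOn hcont).bddAbove
  rwa [Set.image_eq_range] at this

/-- The seminorm `f ↦ sup_{y ∈ K} ‖D^k (f ∘ φ⁻¹)(y)‖` on `C^ω(G, F)`, for `K` a compact subset of
the target of the chart `φ` at `g`. -/
def compactDerivSeminorm (g : G) {K : Set E} (hK : IsCompact K)
    (hKg : K ⊆ (chartAt E g).target) (k : ℕ) : Seminorm ℝ C^ω⟮𝓘(ℝ, E), G; 𝓘(ℝ, F), F⟯ :=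
  Seminorm.of
    (fun f => ⨆ y : K, ‖iteratedFDeriv ℝ k (fun z => f ((chartAt E g).symm z)) y‖)
    (fun f₁ f₂ => by
      refine Real.iSup_le (fun y => ?_) (add_nonneg (Real.iSup_nonneg fun _ => norm_nonneg _)
        (Real.iSup_nonneg fun _ => norm_nonneg _))
      have : iteratedFDeriv ℝ k (fun z => (f₁ + f₂) ((chartAt E g).symm z)) y =
          iteratedFDeriv ℝ k (fun z => f₁ ((chartAt E g).symm z)) y +
            iteratedFDeriv ℝ k (fun z => f₂ ((chartAt E g).symm z)) y :=
        iteratedFDeriv_add_apply (contDiffAt_chart_repr f₁ g (hKg y.2) k)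
          (contDiffAt_chart_repr f₂ g (hKg y.2) k)
      rw [this]
      exact (norm_add_le _ _).trans (add_le_add
        (le_ciSup (bddAbove_range_iteratedFDeriv g hK hKg k f₁) y)
        (le_ciSup (bddAbove_range_iteratedFDeriv g hK hKg k f₂) y)))
    (fun a f => by
      rw [← smul_eq_mul, Real.smul_iSup_of_nonneg (norm_nonneg a)]
      refine iSup_congr fun y => ?_
      have : iteratedFDeriv ℝ k (fun z => (a • f) ((chartAt E g).symm z)) y =
          a • iteratedFDeriv ℝ k (fun z => f ((chartAt E g).symm z)) y :=
        iteratedFDeriv_const_smul_apply (contDiffAt_chart_repr f g (hKg y.2) k)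
      rw [this, norm_smul, smul_eq_mul])

theorem norm_iteratedFDeriv_le_compactDerivSeminorm (g : G) {K : Set E} (hK : IsCompact K)
    (hKg : K ⊆ (chartAt E g).target) (k : ℕ) (f : C^ω⟮𝓘(ℝ, E), G; 𝓘(ℝ, F), F⟯) {y : E}
    (hy : y ∈ K) :
    ‖iteratedFDeriv ℝ k (fun z => f ((chartAt E g).symm z)) y‖ ≤
      compactDerivSeminorm g hK hKg k f :=
  le_ciSup (bddAbove_range_iteratedFDeriv g hK hKg k f) (⟨y, hy⟩ : K)

/-- A family of multilinear maps is bounded if it is so after composition with each continuous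
linear functional. -/
theorem exists_norm_le_of_forall_dual {ι : Type*} {k : ℕ} (m : ι → E [×k]→L[ℝ] F)
    (h : ∀ l : F →L[ℝ] ℝ, ∃ C, ∀ i, ‖l.compContinuousMultilinearMap (m i)‖ ≤ C) :
    ∃ C, ∀ i, ‖m i‖ ≤ C := by
  -- Uniform boundedness is applied to the operators `l ↦ l ∘ m i` on the dual, which is complete
  -- even when `F` is not.
  obtain ⟨C, hC⟩ := banach_steinhaus (g := fun i =>
    (ContinuousLinearMap.compContinuousMultilinearMapL ℝ (fun _ : Fin k => E) F ℝ).flip (m i)) h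
  refine ⟨C, fun i => ContinuousMultilinearMap.opNorm_le_bound
    ((norm_nonneg _).trans (hC i)) fun v => ?_⟩
  obtain ⟨l, hl, hlv⟩ := exists_dual_vector'' ℝ (m i v)
  calc ‖m i v‖ = ‖l.compContinuousMultilinearMap (m i) v‖ := by
        rw [ContinuousLinearMap.compContinuousMultilinearMap_coe, Function.comp_apply, hlv]
        simp
    _ ≤ ‖l.compContinuousMultilinearMap (m i)‖ * ∏ j, ‖v j‖ :=
        ContinuousMultilinearMap.le_opNorm _ _
    _ ≤ C * ∏ j, ‖v j‖ := by
        gcongr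
        refine (((ContinuousLinearMap.compContinuousMultilinearMapL ℝ
          (fun _ : Fin k => E) F ℝ).flip (m i)).le_of_opNorm_le (hC i) l).trans ?_
        exact mul_le_of_le_one_right ((norm_nonneg _).trans (hC i)) hl

/-- For fixed `k` the scalar Cauchy bound `C * r ^ k * k!` is one constant for all of `B × K`, so
uniform boundedness applies. The seminorm therefore belongs to the family defining
`analyticTopology`. -/
theorem bddAbove_compactDerivSeminorm (g : G) {K : Set E} (hK : IsCompact K)
    (hKg : K ⊆ (chartAt E g).target) (k : ℕ) {B : Set C^ω⟮𝓘(ℝ, E), G; 𝓘(ℝ, F), F⟯}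
    (hB : IsBoundedAnalytic B) : BddAbove (compactDerivSeminorm g hK hKg k '' B) := by
  obtain ⟨C, hC⟩ := exists_norm_le_of_forall_dual
    (fun i : B × K => iteratedFDeriv ℝ k (fun z => i.1.1 ((chartAt E g).symm z)) i.2)
    (fun l => by
      obtain ⟨C, r, h⟩ := hB l g K hK hKg
      refine ⟨C * r ^ k * k.factorial, fun i => ?_⟩
      have := h _ (Set.mem_image_of_mem _ i.1.2) i.2 i.2.2 k
      rwa [← l.iteratedFDeriv_comp_left (contDiffAt_chart_repr i.1.1 g (hKg i.2.2) k) le_rfl])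
  refine ⟨max C 0, ?_⟩
  rintro _ ⟨f, hf, rfl⟩
  exact Real.iSup_le (fun y => (hC (⟨f, hf⟩, y)).trans (le_max_left _ _)) (le_max_right _ _)

/-- The convenient topology on `C^ω(G, F)` is finer than the compact `C^∞`-topology. -/
theorem continuous_iteratedFDeriv_analyticTopology (g : G) (k : ℕ) :
    Continuous[analyticTopology E G F, inferInstance]
      fun f : C^ω⟮𝓘(ℝ, E), G; 𝓘(ℝ, F), F⟯ =>
        UniformOnFun.ofFun {K : Set E | IsCompact K ∧ K ⊆ (chartAt E g).target}
          (iteratedFDeriv ℝ k (fun y => f ((chartAt E g).symm y))) := by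
  let _ := analyticTopology E G F
  have : Nonempty {p : Seminorm ℝ C^ω⟮𝓘(ℝ, E), G; 𝓘(ℝ, F), F⟯ //
      ∀ B, IsBoundedAnalytic B → BddAbove (p '' B)} :=
    ⟨⟨0, fun _ _ => ⟨0, by rintro _ ⟨f, _, rfl⟩; simp⟩⟩⟩
  have hs : WithSeminorms (boundedSeminorms E G F) := ⟨rfl⟩
  refine continuous_iff_continuousAt.2 fun f₀ => ?_
  refine UniformOnFun.tendsto_iff_tendstoUniformlyOn.2 fun K hK => ?_
  refine Metric.tendstoUniformlyOn_iff.2 fun ε hε => ?_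
  have := (hs.tendsto_nhds id f₀).1 tendsto_id
    ⟨compactDerivSeminorm g hK.1 hK.2 k, fun B => bddAbove_compactDerivSeminorm g hK.1 hK.2 k⟩ ε hε
  filter_upwards [this] with f hf y hy
  refine lt_of_le_of_lt ?_ hf
  refine le_trans (le_of_eq ?_)
    (norm_iteratedFDeriv_le_compactDerivSeminorm g hK.1 hK.2 k (f - f₀) hy)
  rw [dist_comm, dist_eq_norm]
  congr 1
  exact (iteratedFDeriv_sub_apply (contDiffAt_chart_repr f g (hK.2 hy) k)
    (contDiffAt_chart_repr f₀ g (hK.2 hy) k)).symm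

end FunctionSpaces

/-! ### Continuity of the inclusion and smoothness of the moment mapping -/

section Vectors

variable {E : Type*} [NormedAddCommGroup E] [NormedSpace ℝ E]
  {G : Type*} [TopologicalSpace G] [ChartedSpace E G] [Group G]
  {H : Type*} [NormedAddCommGroup H] [InnerProductSpace ℂ H] (ρ : G →* (H ≃ₗᵢ[ℂ] H))

theorem incl_injective : Function.Injective (incl (E := E) ρ) :=
  Submodule.inclusion_injective _

theorem incl_continuous [IsManifold 𝓘(ℝ, E) ω G] : Continuous (incl (E := E) ρ) := by
  refine continuous_induced_rng.2 (continuous_iInf_rng.2 fun g => continuous_iInf_rng.2 fun k =>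
    continuous_induced_rng.2 ?_)
  let _ := analyticTopology E G H
  have h := continuous_iteratedFDeriv_analyticTopology (E := E) (G := G) (F := H) g k
  have hj : Continuous (AnalyticVectors.orbitMap (E := E) ρ) := continuous_induced_dom
  exact h.comp hj

theorem SmoothVectors.continuous_iteratedFDeriv (g : G) (k : ℕ) {y : E}
    (hy : y ∈ (chartAt E g).target) :
    Continuous fun x : SmoothVectors E ρ =>
      iteratedFDeriv ℝ k (fun z => ρ ((chartAt E g).symm z) x.1) y := by
  have h₁ : Continuous fun x : SmoothVectors E ρ =>
      UniformOnFun.ofFun {K : Set E | IsCompact K ∧ K ⊆ (chartAt E g).target}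
        (iteratedFDeriv ℝ k (fun z => ρ ((chartAt E g).symm z) x.1)) := by
    let _ := compactSmoothTopology E G H
    have h₂ : Continuous fun f : C^∞⟮𝓘(ℝ, E), G; 𝓘(ℝ, H), H⟯ =>
        UniformOnFun.ofFun {K : Set E | IsCompact K ∧ K ⊆ (chartAt E g).target}
          (iteratedFDeriv ℝ k (fun z => f ((chartAt E g).symm z))) :=
      continuous_iInf_dom (i := g) (continuous_iInf_dom (i := k) continuous_induced_dom)
    have hj : Continuous (SmoothVectors.orbitMap (E := E) ρ) := continuous_induced_dom
    exact h₂.comp hj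
  -- Points are compact, so uniform convergence on compact sets controls evaluation at `y`.
  exact (UniformOnFun.uniformContinuous_eval_of_mem (s := {y}) (E [×k]→L[ℝ] H)
    {K : Set E | IsCompact K ∧ K ⊆ (chartAt E g).target} rfl
    ⟨isCompact_singleton, Set.singleton_subset_iff.2 hy⟩).continuous.comp h₁

/-- The inclusion `H_∞ → H`, as a real linear mapping. -/
def SmoothVectors.toHilbert : SmoothVectors E ρ →ₗ[ℝ] H :=
  (orbitRegular E ∞ ρ).subtype.restrictScalars ℝ

theorem SmoothVectors.toHilbert_continuous : Continuous (toHilbert (E := E) ρ) := by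
  have h := SmoothVectors.continuous_iteratedFDeriv (E := E) ρ 1 0 (mem_chart_target E 1)
  have h' := (ContinuousMultilinearMap.apply ℝ (fun _ : Fin 0 => E) H 0).continuous.comp h
  refine h'.congr fun x => ?_
  simp [(chartAt E (1 : G)).left_inv (mem_chart_source E 1)]
  rfl

theorem infRep_eq_fderiv (X : GroupLieAlgebra 𝓘(ℝ, E) G) (x : SmoothVectors E ρ) :
    infRep ρ X x = fderiv ℝ (fun z => ρ ((chartAt E (1 : G)).symm z) x.1)
      (chartAt E (1 : G) 1) (X : E) := by
  have hd : MDifferentiableAt 𝓘(ℝ, E) 𝓘(ℝ, H) (fun g => ρ g x.1) (1 : G) :=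
    (ContMDiff.mdifferentiable x.2 (by simp)) 1
  rw [infRep, hd.mfderiv]
  simp [writtenInExtChartAt, Function.comp_def]
  rfl

variable [IsManifold 𝓘(ℝ, E) ∞ G]

/-- `x ↦ ρ'(X)x`, as a real linear mapping `H_∞ → H`. -/
def infRepLinear (X : GroupLieAlgebra 𝓘(ℝ, E) G) : SmoothVectors E ρ →ₗ[ℝ] H where
  toFun := infRep ρ X
  map_add' x y := by
    have hx := (contDiffAt_comp_chartAt_symm x.2 1 (mem_chart_target E 1)).differentiableAt
      (by simp)
    have hy := (contDiffAt_comp_chartAt_symm y.2 1 (mem_chart_target E 1)).differentiableAt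
      (by simp)
    have h : (fun z => ρ ((chartAt E (1 : G)).symm z) (x + y).1) =
        (fun z => ρ ((chartAt E (1 : G)).symm z) x.1) +
          fun z => ρ ((chartAt E (1 : G)).symm z) y.1 := funext fun z => map_add _ x.1 y.1
    simp only [infRep_eq_fderiv]
    rw [h, fderiv_add hx hy]
    rfl
  map_smul' a x := by
    have hx := (contDiffAt_comp_chartAt_symm x.2 1 (mem_chart_target E 1)).differentiableAt
      (by simp)
    have h : (fun z => ρ ((chartAt E (1 : G)).symm z) (a • x).1) =
        a • fun z => ρ ((chartAt E (1 : G)).symm z) x.1 :=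
      funext fun z => map_smul (ρ ((chartAt E (1 : G)).symm z)) (a : ℂ) x.1
    simp only [infRep_eq_fderiv]
    rw [h, fderiv_const_smul hx]
    rfl

theorem infRepLinear_continuous (X : GroupLieAlgebra 𝓘(ℝ, E) G) :
    Continuous (infRepLinear ρ X) := by
  have h := SmoothVectors.continuous_iteratedFDeriv (E := E) ρ 1 1 (mem_chart_target E 1)
  have h' := (ContinuousMultilinearMap.apply ℝ (fun _ : Fin 1 => E) H
    (fun _ => (X : E))).continuous.comp h
  refine h'.congr fun x => ?_
  refine Eq.trans ?_ (infRep_eq_fderiv ρ X x).symm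
  exact iteratedFDeriv_one_apply (𝕜 := ℝ) (E := E) (F := H) fun _ => (X : E)

theorem contDiff_momentMap_apply [FiniteDimensional ℝ E] {c : ℝ → SmoothVectors E ρ}
    (hc : IsSmoothCurve c) (X : GroupLieAlgebra 𝓘(ℝ, E) G) :
    ContDiff ℝ ∞ fun t => momentMap ρ (c t) X := by
  have h₁ := isSmoothCurve_iff_contDiff (F := H).1
    (hc.map_of_continuous _ (SmoothVectors.toHilbert_continuous ρ))
  have h₂ := isSmoothCurve_iff_contDiff (F := H).1
    (hc.map_of_continuous _ (infRepLinear_continuous ρ X))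
  exact contDiff_const.mul (Complex.imCLM.contDiff.comp (h₁.inner ℂ h₂))

theorem momentMap_isSmoothMap [FiniteDimensional ℝ E] :
    IsSmoothMap (momentMap (E := E) ρ) := by
  intro c hc
  let m : ℝ → E →L[ℝ] ℝ := fun t => momentMap ρ (c t)
  have hm : ContDiff ℝ ∞ m := contDiff_clm_apply_iff.2 (contDiff_momentMap_apply ρ hc)
  exact isSmoothCurve_iff_contDiff.2 hm

end Vectors

/-! ### Real analyticity on analytic vectors -/

section AnalyticVectors

variable {E : Type*} [NormedAddCommGroup E] [NormedSpace ℝ E]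
  {G : Type*} [TopologicalSpace G] [ChartedSpace E G] [Group G] [IsManifold 𝓘(ℝ, E) ω G]
  {H : Type*} [NormedAddCommGroup H] [InnerProductSpace ℂ H] [CompleteSpace H]
  (ρ : G →* (H ≃ₗᵢ[ℂ] H))

/-- A continuous linear mapping from `H_∞` to a Hilbert space maps real analytic curves in `H_ω` to
real analytic curves. -/
theorem IsRealAnalyticCurve.analyticOnNhd_of_continuous {c : ℝ → AnalyticVectors E ρ}
    (hc : IsRealAnalyticCurve c) (L : SmoothVectors E ρ →ₗ[ℝ] H) (hL : Continuous L) :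
    AnalyticOnNhd ℝ (fun t => L (incl ρ (c t))) Set.univ := by
  let _ : InnerProductSpace ℝ H := InnerProductSpace.rclikeToReal ℂ H
  refine analyticOnNhd_of_inner (F := H) fun v => ?_
  -- The functional `x ↦ ⟪v, L (i x)⟫` is continuous on `H_ω`, hence an admissible test for the
  -- curve.
  exact hc ((innerSL ℝ v).toLinearMap ∘ₗ L ∘ₗ (incl ρ).restrictScalars ℝ)
    (isBoundedFunctional_of_continuous _
      ((innerSL ℝ v).continuous.comp (hL.comp (incl_continuous ρ))))

theorem analyticOnNhd_momentMap_apply [FiniteDimensional ℝ E] {c : ℝ → AnalyticVectors E ρ}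
    (hc : IsRealAnalyticCurve c) (X : GroupLieAlgebra 𝓘(ℝ, E) G) :
    AnalyticOnNhd ℝ (fun t => momentMap ρ (incl ρ (c t)) X) Set.univ := by
  have h₁ := hc.analyticOnNhd_of_continuous ρ _ (SmoothVectors.toHilbert_continuous ρ)
  have h₂ := hc.analyticOnNhd_of_continuous ρ _ (infRepLinear_continuous ρ X)
  rw [← contDiff_omega_iff_analyticOnNhd] at h₁ h₂ ⊢
  exact contDiff_const.mul (Complex.imCLM.contDiff.comp (h₁.inner ℂ h₂))

theorem momentMap_incl_isRealAnalyticMap [FiniteDimensional ℝ E] :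
    IsRealAnalyticMap fun x : AnalyticVectors E ρ => momentMap ρ (incl ρ x) := by
  refine ⟨fun c hc => momentMap_isSmoothMap ρ _
    (hc.map_of_continuous ((incl ρ).restrictScalars ℝ) (incl_continuous ρ)), fun c hc l _ => ?_⟩
  let e : Module.Dual ℝ E ≃ₗ[ℝ] (E →L[ℝ] ℝ) := LinearMap.toContinuousLinearMap
  let l' : (E →L[ℝ] ℝ) →ₗ[ℝ] ℝ := l
  -- Reflexivity in finite dimension: every linear functional on `𝔤'` is evaluation at some `X`.
  obtain ⟨X, hX⟩ := (Module.evalEquiv ℝ E).surjective (l' ∘ₗ e.toLinearMap)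
  have h (m : E →L[ℝ] ℝ) : l' m = m X := by
    have := LinearMap.congr_fun hX (e.symm m)
    rw [LinearMap.comp_apply, LinearEquiv.coe_coe, e.apply_symm_apply] at this
    exact this.symm
  have hlX : (fun t => l (momentMap ρ (incl ρ (c t)))) = fun t => momentMap ρ (incl ρ (c t)) X :=
    funext fun t => h _
  rw [hlX]
  exact analyticOnNhd_momentMap_apply ρ hc X

end AnalyticVectors

end UnitaryMoment

end

theorem theorem2p18
    {E : Type*} [NormedAddCommGroup E] [NormedSpace ℝ E] [FiniteDimensional ℝ E]
    {G : Type*} [TopologicalSpace G] [T2Space G] [SecondCountableTopology G]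
    [ChartedSpace E G] [Group G] [LieGroup 𝓘(ℝ, E) ω G]
    {H : Type*} [NormedAddCommGroup H] [InnerProductSpace ℂ H] [CompleteSpace H]
    (ρ : G →* (H ≃ₗᵢ[ℂ] H)) (hρ : ∀ x : H, Continuous fun g : G => ρ g x) :
    Function.Injective (UnitaryMoment.incl (E := E) ρ) ∧
    Continuous (UnitaryMoment.incl (E := E) ρ) ∧
    (∀ (g : G) (x : UnitaryMoment.AnalyticVectors E ρ),
      UnitaryMoment.incl ρ (UnitaryMoment.AnalyticVectors.act ρ g x) =
        UnitaryMoment.SmoothVectors.act ρ g (UnitaryMoment.incl ρ x)) ∧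
    UnitaryMoment.IsSmoothMap (UnitaryMoment.momentMap (E := E) ρ) ∧
    UnitaryMoment.IsRealAnalyticMap
      (fun x : UnitaryMoment.AnalyticVectors E ρ =>
        UnitaryMoment.momentMap ρ (UnitaryMoment.incl ρ x)) := by
  exact ⟨UnitaryMoment.incl_injective ρ, UnitaryMoment.incl_continuous ρ, fun _ _ => rfl,
    UnitaryMoment.momentMap_isSmoothMap ρ, UnitaryMoment.momentMap_incl_isRealAnalyticMap ρ⟩
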